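/- Let $r=u+d+e$ and $p$ be dimensions and let $(\mathbf Y_i,\mathbf X_i)$, $i\ge 1$, be i.i.d. random vectors in $\mathbb R^r\times\mathbb R^p$ with the law of $(\mathbf Y,\mathbf X)$. For a real matrix $\boldsymbol a$ with $k$ columns, let $\psi(\boldsymbol a)$ be the semi-orthogonal matrix obtained by applying the Gram–Schmidt procedure to the columns of $(\mathbf I_k,\boldsymbol a^{\mathsf T})^{\mathsf T}$. The parameter $\boldsymbol\theta=(\boldsymbol\gamma,\mathbf b)\in\mathbb R^q$, $q=(r-u)u+(r-u-d)d$, consists of the (vectorized) entries of a matrix $\boldsymbol\gamma\in\mathbb R^{(r-u)\times u}$ and a matrix $\mathbf b\in\mathbb R^{(r-u-d)\times d}$. Put $\boldsymbol\Gamma=\psi(\boldsymbol\gamma)\in\mathbb R^{r\times u}$ and $\mathbf B=\psi(\mathbf b)\in\mathbb R^{(r-u)\times d}$, and let $\boldsymbol\Gamma_0=\boldsymbol\Gamma_0(\boldsymbol\gamma)\in\mathbb R^{r\times(r-u)}$ and $\mathbf B_0=\mathbf B_0(\mathbf b)\in\mathbb R^{(r-u)\times(r-u-d)}$ be semi-orthogonal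 basis matrices of the orthogonal complements of the column spaces of $\boldsymbol\Gamma$ and $\mathbf B$ (any choice, as functions of $\boldsymbol\gamma$ and $\mathbf b$). Let $\mathbf g:\mathbb R^{r-u-d}\to\mathbb R^{d_g\times 1}$ and $\mathbf h:\mathbb R^{u+p}\to\mathbb R^{1\times d_h}$ be continuously differentiable, let $\boldsymbol\Theta\subset\mathbb R^q$ be the parameter space, and suppose that $\mathrm E\,\mathbf g(\mathbf B_0^{\mathsf T}\boldsymbol\Gamma_0^{\mathsf T}\mathbf Y)$ and $\mathrm E\,\mathbf h(\boldsymbol\Gamma^{\mathsf T}\mathbf Y,\mathbf X)$ exist for $\boldsymbol\theta\in\boldsymbol\Theta$. Define $$\mathbf f(\mathbf y,\mathbf x;\boldsymbol\theta)=\{\mathbf g(\mathbf B_0^{\mathsf T}\boldsymbol\Gamma_0^{\mathsf T}\mathbf y)-\mathrm E\,\mathbf g(\mathbf B_0^{\mathsf T}\boldsymbol\Gamma_0^{\mathsf T}\mathbf Y)\}\{\mathbf h(\boldsymbol\Gamma^{\mathsf T}\mathbf y,\mathbf x)-\mathrm E\,\mathbf h(\boldsymbol\Gamma^{\mathsf T}\mathbf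 Y,\mathbf X)\}\in\mathbb R^{d_g\times d_h}.$$ Suppose that $\mathbf f$ is continuously differentiable in $\boldsymbol\theta$ (continuous on $\boldsymbol\Theta$, $C^1$ on its interior), that the true parameter $\boldsymbol\theta_0\in\boldsymbol\Theta$ satisfies $\mathrm E\,\mathbf f(\mathbf Y,\mathbf X;\boldsymbol\theta_0)=\mathbf 0$, and that the covariance matrix $\mathbf D_1=\mathrm{Var}\{\mathrm{vec}\,\mathbf f(\mathbf Y,\mathbf X;\boldsymbol\theta_0)\}$ exists (finite second moments). Write $\mathbf C_1(\boldsymbol\theta)=\mathrm E\{\partial\,\mathrm{vec}(\mathbf f)(\mathbf Y,\mathbf X;\boldsymbol\theta)/\partial\boldsymbol\theta^{\mathsf T}\}$ and $\mathbf C_1=\mathbf C_1(\boldsymbol\theta_0)$, and assume: (S1) $\mathrm E\,\mathbf f(\mathbf Y,\mathbf X;\boldsymbol\theta)\ne\mathbf 0$ for all $\boldsymbol\theta\in\boldsymbol\Theta$ with $\boldsymbol\theta\neq\boldsymbol\theta_0$, and $\boldsymbol\theta_0$ is an interior point of $\boldsymbol\Theta$; (S2) $\boldsymbol\Theta$ is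 compact; (S3) $\mathrm E\{\sup_{\boldsymbol\theta\in\boldsymbol\Theta}\|\mathbf f(\mathbf Y,\mathbf X;\boldsymbol\theta)\|_2\}<\infty$; (S4) $\mathbf C_1(\boldsymbol\theta)$ exists and is continuous on some neighbourhood $\boldsymbol\Theta_\epsilon\subset\boldsymbol\Theta$ (an open ball) of $\boldsymbol\theta_0$; (S5) $\mathbf C_1$ has full column rank; (S6) $\sup_{\boldsymbol\theta\in\boldsymbol\Theta_\epsilon}\big\|n^{-1}\sum_{i=1}^n\partial\,\mathrm{vec}(\mathbf f)(\mathbf Y_i,\mathbf X_i;\boldsymbol\theta)/\partial\boldsymbol\theta^{\mathsf T}-\mathbf C_1(\boldsymbol\theta)\big\|\to 0$ in probability. Here $\|\mathbf f\|_2$ is the Euclidean norm of $\mathrm{vec}(\mathbf f)$. Let $\hat{\boldsymbol\theta}=\hat{\boldsymbol\theta}_n$ be any random vector that almost surely minimizes $\|\sum_{i=1}^n\mathbf f(\mathbf Y_i,\mathbf X_i;\boldsymbol\theta)\|_2^2$ over $\boldsymbol\theta\in\boldsymbol\Theta$. Then, as $n\to\infty$, $$\sqrt n(\hat{\boldsymbol\theta}-\boldsymbol\theta_0)\xrightarrow{d}\mathcal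 N\big\{\mathbf 0,(\mathbf C_1^{\mathsf T}\mathbf C_1)^{-1}\mathbf C_1^{\mathsf T}\mathbf D_1\mathbf C_1(\mathbf C_1^{\mathsf T}\mathbf C_1)^{-1}\big\}.$$ -/

import Mathlib

open MeasureTheory ProbabilityTheory Filter Topology Matrix

namespace InnerEnvelope

noncomputable section

/-- The full column rank matrix `(I_k ; a)` with upper block the identity and lower block `a`,
which represents its column space by the unrestricted entries of `a`. -/
def reprMatrix {k : ℕ} {ι : Type*} (a : Matrix ι (Fin k) ℝ) : Matrix (Fin k ⊕ ι) (Fin k) ℝ :=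
  Matrix.fromRows (1 : Matrix (Fin k) (Fin k) ℝ) a

/-- The semi-orthogonal basis matrix obtained from `(I_k ; a)` by applying the (normalized)
Gram-Schmidt procedure to its columns. -/
def basisMatrix {k : ℕ} {ι : Type*} [Fintype ι] (a : Matrix ι (Fin k) ℝ) :
    Matrix (Fin k ⊕ ι) (Fin k) ℝ :=
  Matrix.of fun i j =>
    InnerProductSpace.gramSchmidtNormed ℝ
      (fun c : Fin k => WithLp.toLp 2 fun i' : Fin k ⊕ ι => reprMatrix a i' c) j i

/-- `A₀` is a semi-orthogonal basis matrix of the orthogonal complement of the column space of the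
semi-orthogonal matrix `A` (the numbers of columns of `A` and `A₀` add up to the number of rows). -/
def IsOrthComplement {k : ℕ} {ι : Type*} [Fintype ι] [DecidableEq ι]
    (A : Matrix (Fin k ⊕ ι) (Fin k) ℝ) (A₀ : Matrix (Fin k ⊕ ι) ι ℝ) : Prop :=
  A₀ᵀ * A₀ = 1 ∧ Aᵀ * A₀ = 0

/-- Coordinates of the response `Y ∈ ℝ^r`, where `r = u + d + e`; the three subspaces have
dimensions `u`, `d` and `e = r - u - d`. -/
abbrev RespIdx (u d e : ℕ) : Type := Fin u ⊕ (Fin d ⊕ Fin e)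

/-- Coordinates of the parameter `θ = (γ, b) ∈ ℝ^q`, `q = (r - u) u + (r - u - d) d`. Each block
is indexed by (column, row), as in the vectorization of a matrix. -/
abbrev ParamIdx (u d e : ℕ) : Type := (Fin u × (Fin d ⊕ Fin e)) ⊕ (Fin d × Fin e)

/-- The parameter space `ℝ^q` with its Euclidean norm. -/
abbrev Param (u d e : ℕ) : Type := EuclideanSpace ℝ (ParamIdx u d e)

/-- An observation `(y, x) ∈ ℝ^r × ℝ^p`. -/
abbrev Obs (u d e p : ℕ) : Type := (RespIdx u d e → ℝ) × (Fin p → ℝ)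

/-- The block `γ` of `θ`, as a matrix. -/
def gammaPart {u d e : ℕ} (θ : Param u d e) : Matrix (Fin d ⊕ Fin e) (Fin u) ℝ :=
  Matrix.of fun i j => θ (Sum.inl (j, i))

/-- The block `b` of `θ`, as a matrix. -/
def bPart {u d e : ℕ} (θ : Param u d e) : Matrix (Fin e) (Fin d) ℝ :=
  Matrix.of fun i j => θ (Sum.inr (j, i))

/-- The matrix `Γ`, a function of `θ`. -/
def Gam {u d e : ℕ} (θ : Param u d e) : Matrix (RespIdx u d e) (Fin u) ℝ :=
  basisMatrix (gammaPart θ)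

/-- The matrix `B`, a function of `θ`. -/
def BMat {u d e : ℕ} (θ : Param u d e) : Matrix (Fin d ⊕ Fin e) (Fin d) ℝ :=
  basisMatrix (bPart θ)

section Moment

variable {u d e p dg dh : ℕ}
  (Γ₀ : Matrix (Fin d ⊕ Fin e) (Fin u) ℝ → Matrix (RespIdx u d e) (Fin d ⊕ Fin e) ℝ)
  (B₀ : Matrix (Fin e) (Fin d) ℝ → Matrix (Fin d ⊕ Fin e) (Fin e) ℝ)
  (g : (Fin e → ℝ) → (Fin dg → ℝ)) (h : (Fin u → ℝ) × (Fin p → ℝ) → (Fin dh → ℝ))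
  (P : Measure (Obs u d e p))

/-- `g(B₀ᵀ Γ₀ᵀ y)` at the parameter `θ`. -/
def gTerm (θ : Param u d e) (z : Obs u d e p) : Fin dg → ℝ :=
  g ((B₀ (bPart θ))ᵀ *ᵥ ((Γ₀ (gammaPart θ))ᵀ *ᵥ z.1))

/-- `h(Γᵀ y, x)` at the parameter `θ`. -/
def hTerm (θ : Param u d e) (z : Obs u d e p) : Fin dh → ℝ :=
  h ((Gam θ)ᵀ *ᵥ z.1, z.2)

/-- The moment function
`f(y, x; θ) = {g(B₀ᵀ Γ₀ᵀ y) - E g(B₀ᵀ Γ₀ᵀ Y)} {h(Γᵀ y, x) - E h(Γᵀ Y, X)}`, a column times a row,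
where `P` is the law of `(Y, X)`. -/
def momentFun (θ : Param u d e) (z : Obs u d e p) : Matrix (Fin dg) (Fin dh) ℝ :=
  Matrix.vecMulVec
    (gTerm Γ₀ B₀ g θ z - ∫ z', gTerm Γ₀ B₀ g θ z' ∂P)
    (hTerm h θ z - ∫ z', hTerm h θ z' ∂P)

/-- `vec(f)(y, x; θ)`, the columns of `f` stacked, with the Euclidean norm. -/
def momentVec (θ : Param u d e) (z : Obs u d e p) : EuclideanSpace ℝ (Fin dh × Fin dg) :=
  WithLp.toLp 2 (Matrix.vec (momentFun Γ₀ B₀ g h P θ z))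

/-- The Jacobian matrix `∂ vec(f) / ∂ θᵀ` at the observation `z`. -/
def momentJacobian (θ : Param u d e) (z : Obs u d e p) :
    Matrix (Fin dh × Fin dg) (ParamIdx u d e) ℝ :=
  Matrix.of fun i j =>
    fderiv ℝ (fun t => momentVec Γ₀ B₀ g h P t z) θ (EuclideanSpace.single j 1) i

/-- `C₁(θ) = E {∂ vec(f) / ∂ θᵀ}`. -/
def C₁ (θ : Param u d e) : Matrix (Fin dh × Fin dg) (ParamIdx u d e) ℝ :=
  Matrix.of fun i j => ∫ z, momentJacobian Γ₀ B₀ g h P θ z i j ∂P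

/-- `D₁(θ) = Var {vec(f)}`, the covariance matrix. -/
def D₁ (θ : Param u d e) : Matrix (Fin dh × Fin dg) (Fin dh × Fin dg) ℝ :=
  Matrix.of fun i j =>
    covariance (fun z => momentVec Γ₀ B₀ g h P θ z i) (fun z => momentVec Γ₀ B₀ g h P θ z j) P

/-- The asymptotic covariance matrix `(C₁ᵀ C₁)⁻¹ C₁ᵀ D₁ C₁ (C₁ᵀ C₁)⁻¹`. -/
def asympCov (θ : Param u d e) : Matrix (ParamIdx u d e) (ParamIdx u d e) ℝ :=
  ((C₁ Γ₀ B₀ g h P θ)ᵀ * C₁ Γ₀ B₀ g h P θ)⁻¹ * (C₁ Γ₀ B₀ g h P θ)ᵀ * D₁ Γ₀ B₀ g h P θ *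
    C₁ Γ₀ B₀ g h P θ * ((C₁ Γ₀ B₀ g h P θ)ᵀ * C₁ Γ₀ B₀ g h P θ)⁻¹

end Moment

/-- The Frobenius norm `(trace (Aᵀ A))^(1/2)`. -/
def frobNorm {m n : Type*} [Fintype m] [Fintype n] (A : Matrix m n ℝ) : ℝ :=
  Real.sqrt (Aᵀ * A).trace

end

end InnerEnvelope

open InnerEnvelope

/-!
The estimator minimizes the norm of an average of i.i.d. terms `f(θ, ξ i)`, so the theorem is the
asymptotic normality of a generalized method of moments estimator with identity weight. The special
form of the moment function enters only through its continuity in the observation, which makes it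
measurable; the argument is otherwise about a general `f`.

*Consistency.* The functions `θ ↦ f(θ, ξ i)` are i.i.d. random elements of the separable Banach
space `C(Θ, F)`, and they are integrable because of the envelope condition. The strong law of large
numbers in that space is the uniform law `ae_tendstoUniformlyOn_average`. As the limit
`θ ↦ E f(θ, ξ)` is continuous on the compact set `Θ` and vanishes only at `θ₀`, almost surely the
minimizers converge to `θ₀` (`tendsto_of_norm_le_of_tendstoUniformlyOn`).

*Linearization.* Near `θ₀` the derivative of the average `φ` is uniformly close to `A = C₁(θ₀)`, with
probability tending to one. Combining the first-order condition `φ'(θ̂)ᵀ φ(θ̂) = 0` with the mean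
value inequality gives `θ̂ - θ₀ = -(Aᵀ A)⁻¹ Aᵀ φ(θ₀)` up to an error which is a small multiple of
`‖φ(θ₀)‖` (`norm_sub_add_le_of_adjoint_fderiv_apply_eq_zero`). Since `√n φ(θ₀)` is bounded in
probability, the error is `o_P(n^(-1/2))` (`tendstoInMeasure_linearization`).

*Central limit theorem.* By the Cramér–Wold device, `-(Aᵀ A)⁻¹ Aᵀ √n φ(θ₀)` converges to the
centred Gaussian law with the sandwich covariance
(`tendstoInDistribution_inv_sqrt_smul_sum_toEuclideanLin`), and Slutsky's theorem transfers this to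
`√n (θ̂ - θ₀)`.
-/

/-! ### Uniform law of large numbers over a compact set -/

/-- In a second countable metric space every open set is a countable union of balls, so a map is
measurable as soon as its distance to each fixed point is. -/
theorem measurable_of_measurable_dist {α X : Type*} [MeasurableSpace α] [PseudoMetricSpace X]
    [SecondCountableTopology X] [MeasurableSpace X] [BorelSpace X] {f : α → X}
    (hf : ∀ c, Measurable fun a => dist (f a) c) : Measurable f := by
  refine measurable_of_isOpen fun s hs => ?_
  choose r hr hrs using fun x : s => Metric.isOpen_iff.1 hs x x.2
  obtain ⟨T, hT, hTs⟩ := TopologicalSpace.isOpen_iUnion_countable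
    (fun x : s => Metric.ball (x : X) (r x)) fun _ => Metric.isOpen_ball
  have hs' : s = ⋃ x ∈ T, Metric.ball (x : X) (r x) := by
    rw [hTs]
    refine Set.Subset.antisymm (fun x hx => Set.mem_iUnion.2 ⟨⟨x, hx⟩, ?_⟩)
      (Set.iUnion_subset hrs)
    exact Metric.mem_ball_self (hr _)
  rw [hs', Set.preimage_iUnion₂]
  exact MeasurableSet.biUnion hT fun x _ => measurableSet_lt (hf x) measurable_const

/-- A family of continuous functions on a compact metrizable space depends measurably on a
parameter, as an element of `C(K, F)`, when each of its values does: the sup-distance to a fixed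
function is a supremum over a countable dense set. -/
theorem ContinuousMap.measurable_of_measurable_eval {α K F : Type*} [MeasurableSpace α]
    [TopologicalSpace K] [CompactSpace K] [SecondCountableTopology K] [LocallyCompactSpace K]
    [NormedAddCommGroup F] [SecondCountableTopology F] [MeasurableSpace F] [BorelSpace F]
    [MeasurableSpace C(K, F)] [BorelSpace C(K, F)] {f : α → C(K, F)}
    (hf : ∀ x, Measurable fun a => f a x) : Measurable f := by
  refine measurable_of_measurable_dist fun c => measurable_of_Iic fun r => ?_
  obtain ⟨D, hDc, hD⟩ := TopologicalSpace.exists_countable_dense K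
  rcases lt_or_ge r 0 with hr | hr
  · have : (fun a => dist (f a) c) ⁻¹' Set.Iic r = ∅ :=
      Set.eq_empty_of_forall_notMem fun a ha => (ha.trans_lt hr).not_ge dist_nonneg
    rw [this]
    exact MeasurableSet.empty
  have h : (fun a => dist (f a) c) ⁻¹' Set.Iic r = ⋂ x ∈ D, {a | dist (f a x) (c x) ≤ r} := by
    ext a
    simp only [Set.mem_preimage, Set.mem_Iic, Set.mem_iInter, Set.mem_ofPred_eq,
      ContinuousMap.dist_le hr]
    refine ⟨fun h x _ => h x, fun h => ?_⟩
    have hcl : IsClosed {x | dist (f a x) (c x) ≤ r} :=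
      isClosed_le (by fun_prop) continuous_const
    intro x
    exact closure_minimal h hcl (hD x)
  rw [h]
  exact MeasurableSet.biInter hDc fun x _ =>
    measurableSet_le ((hf x).dist measurable_const) measurable_const

/-- The uniform strong law of large numbers over a compact parameter set, for a function which is
continuous in the parameter and has an integrable envelope. It is the strong law for random
elements of the separable Banach space `C(K, F)`. -/
theorem ae_tendstoUniformlyOn_average {Ω Z E F : Type*} [MeasurableSpace Ω] [MeasurableSpace Z]
    {μ : Measure Ω} {P : Measure Z}
    [PseudoMetricSpace E] [NormedAddCommGroup F] [NormedSpace ℝ F]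
    [CompleteSpace F] [SecondCountableTopology F] [MeasurableSpace F] [BorelSpace F]
    {K : Set E} (hK : IsCompact K) {f : E → Z → F}
    (hfc : ∀ z, ContinuousOn (fun θ => f θ z) K) (hfm : ∀ θ, Measurable (f θ))
    (henv : ∫⁻ z, ⨆ θ ∈ K, ‖f θ z‖ₑ ∂P < ⊤)
    {ξ : ℕ → Ω → Z} (hlaw : ∀ i, HasLaw (ξ i) P μ) (hindep : iIndepFun ξ μ) :
    ContinuousOn (fun θ => ∫ z, f θ z ∂P) K ∧
    ∀ᵐ ω ∂μ, TendstoUniformlyOn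
      (fun (n : ℕ) θ => (n : ℝ)⁻¹ • ∑ i ∈ Finset.range n, f θ (ξ i ω))
      (fun θ => ∫ z, f θ z ∂P) atTop K := by
  have : CompactSpace K := isCompact_iff_compactSpace.1 hK
  borelize C(K, F)
  let G : Z → C(K, F) := fun z => ⟨K.domRestrict fun θ => f θ z, (hfc z).domRestrict⟩
  have hGm : Measurable G :=
    ContinuousMap.measurable_of_measurable_eval fun θ => hfm θ
  have hGint : Integrable G P := by
    refine ⟨hGm.aestronglyMeasurable, lt_of_le_of_lt (lintegral_mono fun z => ?_) henv⟩
    rw [ContinuousMap.enorm_eq_iSup_enorm]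
    exact iSup_le fun x => le_iSup₂_of_le x.1 x.2 le_rfl
  have hGae : AEMeasurable G P := hGm.aemeasurable
  have hlawG (i : ℕ) : HasLaw (fun ω => G (ξ i ω)) (P.map G) μ :=
    HasLaw.fun_comp ⟨hGae, rfl⟩ (hlaw i)
  have hslln := strong_law_ae (μ := μ) (fun i ω => G (ξ i ω))
    (by
      have := (hlaw 0).map_eq ▸ hGint
      exact this.comp_aemeasurable (hlaw 0).aemeasurable)
    (fun i j hij => (hindep.indepFun hij).comp hGm hGm)
    (fun i => (hlawG i).identDistrib (hlawG 0))
  have hmean : ∫ ω, G (ξ 0 ω) ∂μ = ∫ z, G z ∂P := by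
    rw [← (hlaw 0).map_eq, integral_map (hlaw 0).aemeasurable hGm.aestronglyMeasurable]
  have heval (θ : K) : (∫ z, G z ∂P) θ = ∫ z, f θ z ∂P :=
    ContinuousMap.integral_apply hGint θ
  rw [hmean] at hslln
  constructor
  · rw [continuousOn_iff_continuous_domRestrict]
    convert (∫ z, G z ∂P).continuous using 1
    ext θ
    exact (heval θ).symm
  · filter_upwards [hslln] with ω hω
    rw [ContinuousMap.tendsto_iff_tendstoUniformly] at hω
    rw [tendstoUniformlyOn_iff_tendstoUniformly_comp_coe]
    convert hω using 1
    · ext n θ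
      simp only [ContinuousMap.smul_apply, ContinuousMap.sum_apply]
      rfl
    · ext θ
      exact (heval θ).symm

/-! ### Consistency of minimum-norm estimators -/

/-- If `G n → G` uniformly on a compact set where `G` has the single zero `x₀`, and `x n` makes
`‖G n‖` no larger than `x₀` does, then `x n → x₀`: every cluster point of `x` is a zero of `G`. -/
theorem tendsto_of_norm_le_of_tendstoUniformlyOn {E F : Type*} [TopologicalSpace E]
    [NormedAddCommGroup F] {K : Set E} (hK : IsCompact K) {G : E → F} (hG : ContinuousOn G K)
    {Gn : ℕ → E → F} (hGn : TendstoUniformlyOn Gn G atTop K) {x₀ : E} (hx₀ : x₀ ∈ K)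
    (h0 : G x₀ = 0) (hne : ∀ y ∈ K, y ≠ x₀ → G y ≠ 0) {x : ℕ → E} (hx : ∀ n, x n ∈ K)
    (hmin : ∀ n, ‖Gn n (x n)‖ ≤ ‖Gn n x₀‖) : Tendsto x atTop (𝓝 x₀) := by
  refine hK.tendsto_nhds_of_unique_mapClusterPt (Eventually.of_forall hx) fun y hy hcl => ?_
  by_contra hyx
  have hzero : Tendsto (fun n => G (x n)) atTop (𝓝 0) := by
    rw [Metric.tendsto_atTop]
    intro ε hε
    obtain ⟨N, hN⟩ := eventually_atTop.1 (Metric.tendstoUniformlyOn_iff.1 hGn (ε / 2) (half_pos hε))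
    refine ⟨N, fun n hn => ?_⟩
    have h1 := hN n hn _ (hx n)
    have h2 := hN n hn _ hx₀
    rw [h0, dist_zero_left] at h2
    rw [dist_zero_right]
    calc ‖G (x n)‖ ≤ dist (G (x n)) (Gn n (x n)) + ‖Gn n (x n)‖ := by
          rw [dist_eq_norm]; simpa using norm_add_le (G (x n) - Gn n (x n)) (Gn n (x n))
      _ < ε := by linarith [hmin n]
  have hcl' : MapClusterPt (G y) atTop (fun n => G (x n)) := by
    have hw : ContinuousWithinAt G K y := hG y hy
    have : ClusterPt y (map x atTop ⊓ 𝓟 K) := by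
      have hle : map x atTop ≤ 𝓟 K := by
        exact tendsto_principal.2 (Eventually.of_forall hx)
      rw [inf_eq_left.2 hle]; exact hcl
    have h3 : (𝓝[K] y ⊓ map x atTop).NeBot := by
      rw [nhdsWithin, inf_assoc, inf_comm (𝓟 K)]; exact this
    exact (h3.map G).mono (le_inf ((map_mono inf_le_left).trans hw)
      ((map_mono inf_le_right).trans (by rw [Filter.map_map]; rfl)))
  exact hne y hy hyx (eq_of_nhds_neBot (NeBot.mono hcl' (inf_le_inf_left _ hzero)))

/-! ### Multivariate central limit theorem -/

/-- The multivariate central limit theorem, by the Cramér–Wold device: the characteristic function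
at `t` of the normalized sum is that of its inner product with `t`, to which the one-dimensional
central limit theorem applies. -/
theorem tendstoInDistribution_inv_sqrt_smul_sum {ι Ω : Type*} [Fintype ι] [DecidableEq ι]
    [MeasurableSpace Ω] {μ : Measure Ω} [IsProbabilityMeasure μ]
    {V : ℕ → Ω → EuclideanSpace ℝ ι} (hL2 : MemLp (V 0) 2 μ) (h0 : ∫ ω, V 0 ω ∂μ = 0)
    (hindep : iIndepFun V μ) (hident : ∀ i, IdentDistrib (V i) (V 0) μ μ)
    {S : Matrix ι ι ℝ} (hS : S.PosSemidef)
    (hvar : ∀ t : EuclideanSpace ℝ ι,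
      Var[fun ω => inner ℝ (V 0 ω) t; μ] = t.ofLp ⬝ᵥ S *ᵥ t.ofLp) :
    TendstoInDistribution (fun (n : ℕ) ω => (√(n : ℝ))⁻¹ • ∑ i ∈ Finset.range n, V i ω) atTop
      (id : EuclideanSpace ℝ ι → EuclideanSpace ℝ ι) (fun _ => μ) (multivariateGaussian 0 S) where
  forall_aemeasurable n :=
    (Finset.aemeasurable_fun_sum _ fun i _ => (hident i).aemeasurable_fst).fun_const_smul _
  tendsto := by
    refine ProbabilityMeasure.tendsto_iff_tendsto_charFun.2 fun t => ?_
    have hm : Measurable fun v : EuclideanSpace ℝ ι => (inner ℝ v t : ℝ) := by fun_prop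
    have hmean : ∫ ω, inner ℝ (V 0 ω) t ∂μ = 0 := by
      have h := integral_inner (𝕜 := ℝ) (hL2.integrable one_le_two) t
      simp_rw [real_inner_comm t] at h ⊢
      rw [h, h0, inner_zero_right]
    have hclt := tendstoInDistribution_inv_sqrt_mul_sum_sub
      (P' := gaussianReal 0 Var[fun ω => inner ℝ (V 0 ω) t; μ].toNNReal)
      (Y := id) (X := fun i ω => inner ℝ (V i ω) t) HasLaw.id
      (hL2.inner_const t) (hindep.comp _ fun _ => hm) (fun i => (hident i).comp hm)
    have hconv := ProbabilityMeasure.tendsto_iff_tendsto_charFun.1 hclt.tendsto 1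
    have hlim : charFun (gaussianReal 0 Var[fun ω => inner ℝ (V 0 ω) t; μ].toNNReal) 1 =
        charFun (multivariateGaussian 0 S) t := by
      rw [charFun_multivariateGaussian hS, charFun_gaussianReal,
        Real.coe_toNNReal _ (variance_nonneg _ _), hvar]
      simp
    simp only [ProbabilityMeasure.coe_mk, Measure.map_id, hlim] at hconv ⊢
    convert hconv using 2 with n
    have hmn : AEMeasurable (fun ω => (√(n : ℝ))⁻¹ • ∑ i ∈ Finset.range n, V i ω) μ :=
      (Finset.aemeasurable_fun_sum _ fun i _ => (hident i).aemeasurable_fst).fun_const_smul _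
    rw [charFun_apply, integral_map hmn (by fun_prop), charFun_apply, integral_map]
    · congr with ω
      simp [hmean, inner_smul_left, sum_inner]
    · refine .const_mul (.sub_const (Finset.aemeasurable_fun_sum _ fun i _ => ?_) _) _
      exact hm.comp_aemeasurable (hident i).aemeasurable_fst
    · fun_prop

/-- A sequence which converges in distribution is bounded in probability. -/
theorem exists_measure_norm_gt_le_of_tendstoInDistribution {E Ω Ω' : Type*}
    [NormedAddCommGroup E] [InnerProductSpace ℝ E] [FiniteDimensional ℝ E] [MeasurableSpace E]
    [BorelSpace E] [MeasurableSpace Ω] [MeasurableSpace Ω'] {μ : Measure Ω} {ν : Measure Ω'}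
    [IsProbabilityMeasure μ] [IsProbabilityMeasure ν] {X : ℕ → Ω → E} {W : Ω' → E}
    (h : TendstoInDistribution X atTop W (fun _ => μ) ν) {η : ENNReal} (hη : 0 < η) :
    ∃ R : ℝ, 0 < R ∧ ∀ n, μ {ω | R < ‖X n ω‖} ≤ η := by
  have hX := h.forall_aemeasurable
  have (n : ℕ) : IsProbabilityMeasure (μ.map (X n)) := Measure.isProbabilityMeasure_map (hX n)
  have : IsProbabilityMeasure (ν.map W) :=
    Measure.isProbabilityMeasure_map h.aemeasurable_limit
  have htight : IsTightMeasureSet (Set.range fun n => μ.map (X n)) :=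
    isTightMeasureSet_of_tendsto_charFun (f := charFun (ν.map W))
      continuous_charFun.continuousAt
      (fun t => ProbabilityMeasure.tendsto_iff_tendsto_charFun.1 h.tendsto t)
  obtain ⟨R, hR, hR0⟩ := (((tendsto_measure_norm_gt_of_isTightMeasureSet htight).eventually_lt_const
    hη).and (eventually_gt_atTop 0)).exists
  refine ⟨R, hR0, fun n => ?_⟩
  have hle := le_iSup₂ (f := fun (ν : Measure E) (_ : ν ∈ Set.range fun n => μ.map (X n)) =>
    ν {x | R < ‖x‖}) _ (Set.mem_range_self n)
  have hset : MeasurableSet {x : E | R < ‖x‖} := measurableSet_lt measurable_const measurable_norm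
  rw [Measure.map_apply_of_aemeasurable (hX n) hset] at hle
  exact hle.trans hR.le

/-! ### Asymptotic linearity of minimum-norm estimators -/

section Linearization

variable {E F : Type*} [NormedAddCommGroup E] [InnerProductSpace ℝ E] [CompleteSpace E]
  [NormedAddCommGroup F] [InnerProductSpace ℝ F] [CompleteSpace F]

open ContinuousLinearMap in
/-- The first-order condition `Jᵀ φ(x) = 0` for a local minimum of `‖φ‖²`. -/
theorem adjoint_fderiv_apply_eq_zero_of_isLocalMin {φ : E → F} {x : E}
    (hd : DifferentiableAt ℝ φ x) (hmin : IsLocalMin (fun y => ‖φ y‖ ^ 2) x) :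
    adjoint (fderiv ℝ φ x) (φ x) = 0 := by
  have h := hmin.hasFDerivAt_eq_zero hd.hasFDerivAt.norm_sq
  refine ext_inner_right ℝ fun v => ?_
  have hv := congrArg (fun T : E →L[ℝ] ℝ => T v) h
  rw [adjoint_inner_left, inner_zero_left]
  simpa using hv

open ContinuousLinearMap in
/-- Linearization of a stationary point `x` of `‖φ‖²`, where the derivative of `φ` stays within
`η` of `A` and `N` is the inverse of `Aᵀ A`: the displacement `x - x₀` agrees with
`-N Aᵀ φ(x₀)` up to an error of order `η ‖φ(x₀)‖`. Substituting
`φ(x) ≈ φ(x₀) + A (x - x₀)` in the first-order condition bounds the error by a multiple of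
`η (‖φ(x₀)‖ + ‖x - x₀‖)`, and for small `η` this bounds `x - x₀` itself. -/
theorem norm_sub_add_le_of_adjoint_fderiv_apply_eq_zero {φ : E → F} {x₀ x : E} {r η : ℝ}
    {A : E →L[ℝ] F} {N : E →L[ℝ] E} (hN : N ∘L adjoint A ∘L A = ContinuousLinearMap.id ℝ E)
    (hd : ∀ y ∈ Metric.ball x₀ r, DifferentiableAt ℝ φ y)
    (hA : ∀ y ∈ Metric.ball x₀ r, ‖fderiv ℝ φ y - A‖ ≤ η)
    (hx : x ∈ Metric.ball x₀ r) (hfoc : adjoint (fderiv ℝ φ x) (φ x) = 0)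
    (hη1 : η ≤ 1) (hηk : η * (‖N‖ * (2 * ‖A‖ + 1)) ≤ 1 / 2) :
    ‖(x - x₀) + N (adjoint A (φ x₀))‖ ≤
      η * ((‖N‖ * (2 * ‖A‖ + 1)) * (‖N‖ * (2 * ‖A‖ + 1) + 2)) * ‖φ x₀‖ := by
  set k := ‖N‖ * (2 * ‖A‖ + 1) with hk
  have hk0 : 0 ≤ k := by positivity
  have hη0 : 0 ≤ η := (norm_nonneg _).trans (hA x hx)
  have hx₀ : x₀ ∈ Metric.ball x₀ r := Metric.mem_ball_self (Metric.pos_of_mem_ball hx)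
  set D := fderiv ℝ φ x - A with hD
  set R := φ x - φ x₀ - A (x - x₀) with hR
  have hRle : ‖R‖ ≤ η * ‖x - x₀‖ :=
    (convex_ball x₀ r).norm_image_sub_le_of_norm_hasFDerivWithin_le'
      (fun y hy => (hd y hy).hasFDerivAt.hasFDerivWithinAt) hA hx₀ hx
  have hφx : ‖φ x‖ ≤ ‖φ x₀‖ + (‖A‖ + 1) * ‖x - x₀‖ := by
    have h1 : φ x = φ x₀ + A (x - x₀) + R := by rw [hR]; abel
    rw [h1]
    refine (norm_add₃_le).trans ?_
    have h2 := A.le_opNorm (x - x₀)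
    nlinarith [norm_nonneg (x - x₀), mul_le_mul_of_nonneg_right hη1 (norm_nonneg (x - x₀))]
  have hdec : (x - x₀) + N (adjoint A (φ x₀)) = -N (adjoint D (φ x) + adjoint A R) := by
    have h1 : N (adjoint A (A (x - x₀))) = x - x₀ := by
      simpa using congrArg (fun T : E →L[ℝ] E => T (x - x₀)) hN
    have h2 : adjoint D (φ x) = -adjoint A (φ x) := by
      rw [hD, map_sub, _root_.sub_apply, hfoc, zero_sub]
    rw [h2, hR]
    nth_rewrite 1 [← h1]
    simp only [map_sub, map_add, map_neg]
    abel
  have hDn : ‖adjoint D (φ x)‖ ≤ η * ‖φ x‖ := by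
    refine ((adjoint D).le_opNorm _).trans ?_
    rw [LinearIsometryEquiv.norm_map]
    exact mul_le_mul_of_nonneg_right (hA x hx) (norm_nonneg _)
  have hRn : ‖adjoint A R‖ ≤ ‖A‖ * (η * ‖x - x₀‖) := by
    refine ((adjoint A).le_opNorm _).trans ?_
    rw [LinearIsometryEquiv.norm_map]
    exact mul_le_mul_of_nonneg_left hRle (norm_nonneg _)
  have hmain : ‖(x - x₀) + N (adjoint A (φ x₀))‖ ≤ η * k * (‖φ x₀‖ + ‖x - x₀‖) := by
    rw [hdec, norm_neg]
    calc ‖N (adjoint D (φ x) + adjoint A R)‖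
        ≤ ‖N‖ * (η * (‖φ x₀‖ + (‖A‖ + 1) * ‖x - x₀‖) + ‖A‖ * (η * ‖x - x₀‖)) := by
          refine (N.le_opNorm _).trans (mul_le_mul_of_nonneg_left ?_ (norm_nonneg _))
          refine (norm_add_le _ _).trans (add_le_add (hDn.trans ?_) hRn)
          exact mul_le_mul_of_nonneg_left hφx hη0
      _ = η * ‖N‖ * ((2 * ‖A‖ + 1) * ‖x - x₀‖ + ‖φ x₀‖) := by ring
      _ ≤ η * ‖N‖ * ((2 * ‖A‖ + 1) * ‖x - x₀‖ + (2 * ‖A‖ + 1) * ‖φ x₀‖) := by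
          refine mul_le_mul_of_nonneg_left (add_le_add_right ?_ _) (by positivity)
          exact le_mul_of_one_le_left (norm_nonneg _) (by linarith [norm_nonneg A])
      _ = η * k * (‖φ x₀‖ + ‖x - x₀‖) := by rw [hk]; ring
  have hlin : ‖N (adjoint A (φ x₀))‖ ≤ k / 2 * ‖φ x₀‖ := by
    have h1 : ‖adjoint A (φ x₀)‖ ≤ ‖A‖ * ‖φ x₀‖ := by
      refine ((adjoint A).le_opNorm _).trans ?_
      rw [LinearIsometryEquiv.norm_map]
    calc ‖N (adjoint A (φ x₀))‖ ≤ ‖N‖ * (‖A‖ * ‖φ x₀‖) :=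
          (N.le_opNorm _).trans (mul_le_mul_of_nonneg_left h1 (norm_nonneg _))
      _ ≤ k / 2 * ‖φ x₀‖ := by
          rw [← mul_assoc]
          refine mul_le_mul_of_nonneg_right ?_ (norm_nonneg _)
          rw [hk]
          nlinarith [norm_nonneg N]
  have hsize : ‖x - x₀‖ ≤ (k + 1) * ‖φ x₀‖ := by
    have h1 : ‖x - x₀‖ ≤ ‖(x - x₀) + N (adjoint A (φ x₀))‖ + ‖N (adjoint A (φ x₀))‖ := by
      simpa using norm_sub_le ((x - x₀) + N (adjoint A (φ x₀))) (N (adjoint A (φ x₀)))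
    have h2 : η * k * (‖φ x₀‖ + ‖x - x₀‖) ≤ 1 / 2 * (‖φ x₀‖ + ‖x - x₀‖) :=
      mul_le_mul_of_nonneg_right hηk (by positivity)
    linarith
  refine hmain.trans ?_
  calc η * k * (‖φ x₀‖ + ‖x - x₀‖) ≤ η * k * (‖φ x₀‖ + (k + 1) * ‖φ x₀‖) := by gcongr
    _ = η * (k * (k + 2)) * ‖φ x₀‖ := by ring

open ContinuousLinearMap in
/-- Asymptotic linearity of minimum-norm estimators: with `A = C θ₀` and `N = (Aᵀ A)⁻¹`, a
consistent local minimizer of `‖∑ f(θ, ξ i)‖²` satisfies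
`√n (θ̂ - θ₀) = -N Aᵀ n^(-1/2) ∑ f(θ₀, ξ i) + o_P(1)`, if the averaged derivatives are uniformly
close to `C` in probability near `θ₀` and the normalized sums at `θ₀` are bounded in probability. -/
theorem tendstoInMeasure_linearization {Ω Z : Type*} [MeasurableSpace Ω] {μ : Measure Ω}
    {f : E → Z → F} {ξ : ℕ → Ω → Z} {θ₀ : E} {ε : ℝ} (hε : 0 < ε)
    (hd : ∀ z, ∀ θ ∈ Metric.ball θ₀ ε, DifferentiableAt ℝ (fun t => f t z) θ)
    {C : E → E →L[ℝ] F} (hC : ContinuousAt C θ₀)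
    (hunif : ∀ δ : ℝ, 0 < δ → Tendsto (fun n : ℕ => μ {ω | ∃ θ ∈ Metric.ball θ₀ ε,
      δ ≤ ‖(n : ℝ)⁻¹ • ∑ i ∈ Finset.range n, fderiv ℝ (fun t => f t (ξ i ω)) θ - C θ‖})
      atTop (𝓝 0))
    {θhat : ℕ → Ω → E} (hcons : TendstoInMeasure μ θhat atTop fun _ => θ₀)
    (hmin : ∀ n, ∀ᵐ ω ∂μ, θhat n ω ∈ Metric.ball θ₀ ε →
      IsLocalMin (fun θ => ‖∑ i ∈ Finset.range n, f θ (ξ i ω)‖ ^ 2) (θhat n ω))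
    {N : E →L[ℝ] E} (hN : N ∘L adjoint (C θ₀) ∘L C θ₀ = ContinuousLinearMap.id ℝ E)
    (hbdd : ∀ η : ENNReal, 0 < η → ∃ R : ℝ, 0 < R ∧ ∀ n : ℕ,
      μ {ω | R < ‖(√(n : ℝ))⁻¹ • ∑ i ∈ Finset.range n, f θ₀ (ξ i ω)‖} ≤ η) :
    TendstoInMeasure μ (fun (n : ℕ) ω => √(n : ℝ) • (θhat n ω - θ₀) +
      N (adjoint (C θ₀) ((√(n : ℝ))⁻¹ • ∑ i ∈ Finset.range n, f θ₀ (ξ i ω))))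
      atTop (fun _ => 0) := by
  rw [tendstoInMeasure_iff_norm]
  intro δ hδ
  rw [ENNReal.tendsto_atTop_zero]
  intro ρ hρ
  obtain ⟨R, hR0, hR⟩ := hbdd (ρ / 2) (ENNReal.half_pos hρ.ne')
  set k := ‖N‖ * (2 * ‖C θ₀‖ + 1) with hk
  have hk0 : 0 ≤ k := by positivity
  -- `2 η` bounds the distance of the averaged derivatives to `C θ₀`; it is chosen so small that
  -- the linearization error is below `δ` as long as the normalized sum is at most `R`
  obtain ⟨η, hη0, hη1, hηk, hηδ⟩ : ∃ η : ℝ, 0 < η ∧ 2 * η ≤ 1 ∧ 2 * η * k ≤ 1 / 2 ∧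
      2 * η * (k * (k + 2)) * R < δ := by
    have hev (c b : ℝ) (hb : 0 < b) : ∀ᶠ η in 𝓝[>] (0 : ℝ), η * c < b := by
      have : Tendsto (fun η : ℝ => η * c) (𝓝 0) (𝓝 (0 * c)) := tendsto_id.mul_const c
      rw [zero_mul] at this
      exact (this.mono_left nhdsWithin_le_nhds).eventually_lt_const hb
    obtain ⟨η, h1, h2, h3, h4⟩ := ((hev 2 1 one_pos).and ((hev (2 * k) (1 / 2) (by norm_num)).and
      ((hev (2 * (k * (k + 2)) * R) δ hδ).and self_mem_nhdsWithin))).exists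
    exact ⟨η, h4, by linarith, by linarith, by linarith⟩
  obtain ⟨r, hr0, hr⟩ := Metric.continuousAt_iff.1 hC η hη0
  set r' := min r ε with hr'
  have hr'0 : 0 < r' := lt_min hr0 hε
  have hbad := (hunif η hη0).add ((tendstoInMeasure_iff_dist.1 hcons) r' hr'0)
  rw [add_zero] at hbad
  obtain ⟨n₀, hn₀⟩ := ENNReal.tendsto_atTop_zero.1 hbad (ρ / 2) (ENNReal.half_pos hρ.ne')
  refine ⟨max n₀ 1, fun n hn => ?_⟩
  have hn1 : 1 ≤ n := (le_max_right _ _).trans hn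
  have hnpos : (0 : ℝ) < n := by exact_mod_cast hn1
  set B₁ : Set Ω := {ω | ∃ θ ∈ Metric.ball θ₀ ε,
      η ≤ ‖(n : ℝ)⁻¹ • ∑ i ∈ Finset.range n, fderiv ℝ (fun t => f t (ξ i ω)) θ - C θ‖} with hB₁
  set B₂ : Set Ω := {ω | r' ≤ dist (θhat n ω) θ₀} with hB₂
  set B₃ : Set Ω := {ω | R < ‖(√(n : ℝ))⁻¹ • ∑ i ∈ Finset.range n, f θ₀ (ξ i ω)‖} with hB₃
  have hsub : ∀ᵐ ω ∂μ, ω ∈ {ω | δ ≤ ‖√(n : ℝ) • (θhat n ω - θ₀) + N (adjoint (C θ₀)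
      ((√(n : ℝ))⁻¹ • ∑ i ∈ Finset.range n, f θ₀ (ξ i ω))) - 0‖} → ω ∈ (B₁ ∪ B₂) ∪ B₃ := by
    filter_upwards [hmin n] with ω hω hωδ
    by_contra hgood
    simp only [Set.mem_union, not_or] at hgood
    obtain ⟨⟨h1, h2⟩, h3⟩ := hgood
    have hball : θhat n ω ∈ Metric.ball θ₀ r' := Metric.mem_ball.2 (not_le.1 h2)
    have hsubε : Metric.ball θ₀ r' ⊆ Metric.ball θ₀ ε := Metric.ball_subset_ball (min_le_right _ _)
    have hfd (y : E) (hy : y ∈ Metric.ball θ₀ r') :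
        HasFDerivAt (fun t => (n : ℝ)⁻¹ • ∑ i ∈ Finset.range n, f t (ξ i ω))
          ((n : ℝ)⁻¹ • ∑ i ∈ Finset.range n, fderiv ℝ (fun t => f t (ξ i ω)) y) y :=
      (HasFDerivAt.fun_sum fun i _ => (hd (ξ i ω) y (hsubε hy)).hasFDerivAt).const_smul _
    have hfoc : IsLocalMin (fun t => ‖(n : ℝ)⁻¹ • ∑ i ∈ Finset.range n, f t (ξ i ω)‖ ^ 2)
        (θhat n ω) := by
      filter_upwards [hω (hsubε hball)] with y hy
      simp only [norm_smul, mul_pow]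
      exact mul_le_mul_of_nonneg_left hy (by positivity)
    have hlin := norm_sub_add_le_of_adjoint_fderiv_apply_eq_zero (η := 2 * η) hN
      (fun y hy => (hfd y hy).differentiableAt) (fun y hy => ?_) hball
      (adjoint_fderiv_apply_eq_zero_of_isLocalMin (hfd _ hball).differentiableAt hfoc) hη1 hηk
    · refine absurd hωδ (not_le.2 ?_)
      have hsq : √(n : ℝ) * (n : ℝ)⁻¹ = (√(n : ℝ))⁻¹ := by
        rw [← div_eq_mul_inv, Real.sqrt_div_self]
      have hscale : √(n : ℝ) • (θhat n ω - θ₀) + N (adjoint (C θ₀)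
          ((√(n : ℝ))⁻¹ • ∑ i ∈ Finset.range n, f θ₀ (ξ i ω))) - 0 =
          √(n : ℝ) • ((θhat n ω - θ₀) + N (adjoint (C θ₀)
          ((n : ℝ)⁻¹ • ∑ i ∈ Finset.range n, f θ₀ (ξ i ω)))) := by
        rw [sub_zero, smul_add, ← map_smul, ← map_smul, smul_smul, hsq]
      have hscale' : √(n : ℝ) * ‖(n : ℝ)⁻¹ • ∑ i ∈ Finset.range n, f θ₀ (ξ i ω)‖ =
          ‖(√(n : ℝ))⁻¹ • ∑ i ∈ Finset.range n, f θ₀ (ξ i ω)‖ := by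
        rw [← hsq, mul_smul, norm_smul (√(n : ℝ)), Real.norm_of_nonneg (Real.sqrt_nonneg _)]
      rw [hscale, norm_smul, Real.norm_of_nonneg (Real.sqrt_nonneg _)]
      calc √(n : ℝ) * ‖(θhat n ω - θ₀) + N (adjoint (C θ₀)
            ((n : ℝ)⁻¹ • ∑ i ∈ Finset.range n, f θ₀ (ξ i ω)))‖
          ≤ √(n : ℝ) * (2 * η * (k * (k + 2)) *
              ‖(n : ℝ)⁻¹ • ∑ i ∈ Finset.range n, f θ₀ (ξ i ω)‖) :=
            mul_le_mul_of_nonneg_left hlin (Real.sqrt_nonneg _)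
        _ = 2 * η * (k * (k + 2)) * ‖(√(n : ℝ))⁻¹ • ∑ i ∈ Finset.range n, f θ₀ (ξ i ω)‖ := by
            rw [← hscale']; ring
        _ ≤ 2 * η * (k * (k + 2)) * R :=
            mul_le_mul_of_nonneg_left (not_lt.1 h3) (by positivity)
        _ < δ := hηδ
    · rw [(hfd y hy).fderiv]
      have ha : ‖(n : ℝ)⁻¹ • ∑ i ∈ Finset.range n, fderiv ℝ (fun t => f t (ξ i ω)) y - C y‖ < η :=
        not_le.1 fun h => h1 ⟨y, hsubε hy, h⟩
      have hb : ‖C y - C θ₀‖ < η := by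
        rw [← dist_eq_norm]
        exact hr (lt_of_lt_of_le hy (min_le_left _ _))
      calc _ ≤ _ := norm_sub_le_norm_sub_add_norm_sub _ (C y) _
        _ ≤ 2 * η := by linarith
  calc _ ≤ μ ((B₁ ∪ B₂) ∪ B₃) := measure_mono_ae hsub
    _ ≤ (μ B₁ + μ B₂) + μ B₃ :=
        (measure_union_le _ _).trans (add_le_add_left (measure_union_le _ _) _)
    _ ≤ ρ / 2 + ρ / 2 := add_le_add (hn₀ n ((le_max_left _ _).trans hn)) (hR n)
    _ = ρ := ENNReal.add_halves ρ

end Linearization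

/-! ### Matrices and covariances -/

namespace InnerEnvelope

/-- The Frobenius norm bounds the operator norm. -/
theorem norm_toEuclideanLin_apply_le {m n : Type*} [Fintype m] [Fintype n] [DecidableEq n]
    (M : Matrix m n ℝ) (x : EuclideanSpace ℝ n) :
    ‖M.toEuclideanLin x‖ ≤ frobNorm M * ‖x‖ := by
  have htr : (Mᵀ * M).trace = ∑ i, ∑ j, M i j ^ 2 := by
    simp only [Matrix.trace, Matrix.diag_apply, Matrix.mul_apply, Matrix.transpose_apply]
    rw [Finset.sum_comm]
    simp only [sq]
  rw [frobNorm, htr, EuclideanSpace.norm_eq, EuclideanSpace.norm_eq,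
    ← Real.sqrt_mul (by positivity), Finset.sum_mul]
  refine Real.sqrt_le_sqrt (Finset.sum_le_sum fun i _ => ?_)
  simp only [Matrix.ofLp_toLpLin, Matrix.toLin'_apply, Real.norm_eq_abs, sq_abs, Matrix.mulVec,
    dotProduct]
  exact Finset.sum_mul_sq_le_sq_mul_sq _ _ _

theorem norm_toEuclideanLin_toContinuousLinearMap_le {m n : Type*} [Fintype m] [Fintype n]
    [DecidableEq n] (M : Matrix m n ℝ) :
    ‖LinearMap.toContinuousLinearMap M.toEuclideanLin‖ ≤ frobNorm M :=
  ContinuousLinearMap.opNorm_le_bound _ (Real.sqrt_nonneg _) (norm_toEuclideanLin_apply_le M)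

/-- The quadratic form of a covariance matrix is the variance of the linear combination. -/
theorem variance_inner_eq_dotProduct {κ Ω : Type*} [Fintype κ] [MeasurableSpace Ω] {μ : Measure Ω}
    [IsProbabilityMeasure μ] {W : Ω → EuclideanSpace ℝ κ} (hW : MemLp W 2 μ)
    (t : EuclideanSpace ℝ κ) :
    Var[fun ω => inner ℝ (W ω) t; μ] =
      t.ofLp ⬝ᵥ (Matrix.of fun i j => cov[fun ω => W ω i, fun ω => W ω j; μ]) *ᵥ t.ofLp := by
  have h : (fun ω => inner ℝ (W ω) t) = fun ω => ∑ i, t i * W ω i := by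
    ext ω; simp [PiLp.inner_apply]
  rw [h, variance_fun_sum fun i => (hW.eval_piLp i).const_mul (t i)]
  simp only [dotProduct, Matrix.mulVec, Matrix.of_apply, Finset.mul_sum,
    covariance_const_mul_left, covariance_const_mul_right]
  refine Finset.sum_congr rfl fun i _ => Finset.sum_congr rfl fun j _ => ?_
  ring

theorem posSemidef_of_cov {κ Ω : Type*} [Fintype κ] [MeasurableSpace Ω] {μ : Measure Ω}
    [IsProbabilityMeasure μ] {W : Ω → EuclideanSpace ℝ κ} (hW : MemLp W 2 μ) :
    (Matrix.of fun i j => cov[fun ω => W ω i, fun ω => W ω j; μ]).PosSemidef := by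
  refine Matrix.PosSemidef.of_dotProduct_mulVec_nonneg ?_ fun x => ?_
  · ext i j
    simp [covariance_comm]
  · have h := variance_inner_eq_dotProduct hW (WithLp.toLp 2 x)
    rw [star_trivial]
    exact h ▸ variance_nonneg _ _

/-- The Gram matrix `Aᵀ A` of a matrix of full column rank is invertible. -/
theorem isUnit_transpose_mul_self_of_rank {m n : Type*} [Fintype m] [Fintype n] [DecidableEq n]
    {A : Matrix m n ℝ} (hA : A.rank = Fintype.card n) : IsUnit (Aᵀ * A) := by
  rw [← Matrix.rank_transpose_mul_self] at hA
  rw [← Matrix.mulVec_surjective_iff_isUnit]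
  have h : Module.finrank ℝ (LinearMap.range (Aᵀ * A).mulVecLin) = Module.finrank ℝ (n → ℝ) := by
    rw [Module.finrank_fintype_fun_eq_card]; exact hA
  exact LinearMap.range_eq_top.1 (Submodule.eq_top_of_finrank_eq h)

end InnerEnvelope

namespace InnerEnvelope

theorem toEuclideanLin_mul_apply {l m n : Type*} [Fintype m] [Fintype n] [DecidableEq m]
    [DecidableEq n] (A : Matrix l m ℝ) (B : Matrix m n ℝ) (x : EuclideanSpace ℝ n) :
    (A * B).toEuclideanLin x = A.toEuclideanLin (B.toEuclideanLin x) := by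
  rw [Matrix.toLpLin_mul (q := 2)]; rfl

theorem inner_toEuclideanLin_left {m n : Type*} [Fintype m] [Fintype n] [DecidableEq m]
    [DecidableEq n] (A : Matrix m n ℝ) (x : EuclideanSpace ℝ n) (y : EuclideanSpace ℝ m) :
    inner ℝ (A.toEuclideanLin x) y = inner ℝ x (Aᵀ.toEuclideanLin y) := by
  rw [← Matrix.conjTranspose_eq_transpose_of_trivial, Matrix.toEuclideanLin_conjTranspose_eq_adjoint,
    LinearMap.adjoint_inner_right]

theorem adjoint_toContinuousLinearMap_toEuclideanLin {m n : Type*} [Fintype m] [Fintype n]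
    [DecidableEq m] [DecidableEq n] (A : Matrix m n ℝ) :
    ContinuousLinearMap.adjoint (LinearMap.toContinuousLinearMap A.toEuclideanLin) =
      LinearMap.toContinuousLinearMap Aᵀ.toEuclideanLin := by
  refine ((ContinuousLinearMap.eq_adjoint_iff _ _).2 fun x y => ?_).symm
  simp only [LinearMap.coe_toContinuousLinearMap']
  rw [inner_toEuclideanLin_left, Matrix.transpose_transpose]

/-- The multivariate central limit theorem for a linear image of the summands. -/
theorem tendstoInDistribution_inv_sqrt_smul_sum_toEuclideanLin {ι κ Ω : Type*} [Fintype ι]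
    [DecidableEq ι] [Fintype κ] [DecidableEq κ] [MeasurableSpace Ω] {μ : Measure Ω}
    [IsProbabilityMeasure μ] {W : ℕ → Ω → EuclideanSpace ℝ κ} (hL2 : MemLp (W 0) 2 μ)
    (h0 : ∫ ω, W 0 ω ∂μ = 0) (hindep : iIndepFun W μ)
    (hident : ∀ i, IdentDistrib (W i) (W 0) μ μ) (M : Matrix ι κ ℝ) :
    TendstoInDistribution
      (fun (n : ℕ) ω => (√(n : ℝ))⁻¹ • ∑ i ∈ Finset.range n, M.toEuclideanLin (W i ω)) atTop
      (id : EuclideanSpace ℝ ι → EuclideanSpace ℝ ι) (fun _ => μ)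
      (multivariateGaussian 0
        (M * (Matrix.of fun i j => cov[fun ω => W 0 ω i, fun ω => W 0 ω j; μ]) * Mᵀ)) := by
  set T := LinearMap.toContinuousLinearMap M.toEuclideanLin with hT
  have hTm : Measurable T := T.continuous.measurable
  refine tendstoInDistribution_inv_sqrt_smul_sum (V := fun i ω => M.toEuclideanLin (W i ω))
    (T.comp_memLp' hL2) ?_ (hindep.comp (fun _ => T) fun _ => hTm) (fun i => (hident i).comp hTm)
    ?_ fun t => ?_
  · have h := T.integral_comp_comm (hL2.integrable one_le_two)
    rw [h0, map_zero] at h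
    exact h
  · rw [← Matrix.conjTranspose_eq_transpose_of_trivial]
    exact (posSemidef_of_cov hL2).mul_mul_conjTranspose_same M
  · simp_rw [inner_toEuclideanLin_left]
    rw [variance_inner_eq_dotProduct hL2, Matrix.ofLp_toLpLin, Matrix.toLin'_apply,
      ← Matrix.mulVec_mulVec, ← Matrix.mulVec_mulVec, Matrix.dotProduct_mulVec _ M,
      ← Matrix.mulVec_transpose]

section Moment

variable {u d e p dg dh : ℕ}
  {Γ₀ : Matrix (Fin d ⊕ Fin e) (Fin u) ℝ → Matrix (RespIdx u d e) (Fin d ⊕ Fin e) ℝ}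
  {B₀ : Matrix (Fin e) (Fin d) ℝ → Matrix (Fin d ⊕ Fin e) (Fin e) ℝ}
  {g : (Fin e → ℝ) → (Fin dg → ℝ)} {h : (Fin u → ℝ) × (Fin p → ℝ) → (Fin dh → ℝ)}
  {P : Measure (Obs u d e p)}

theorem continuous_momentVec (hg : Continuous g) (hh : Continuous h) (θ : Param u d e) :
    Continuous (momentVec Γ₀ B₀ g h P θ) := by
  have h1 : Continuous (gTerm Γ₀ B₀ g θ : Obs u d e p → Fin dg → ℝ) := by
    unfold gTerm; fun_prop
  have h2 : Continuous (hTerm h θ : Obs u d e p → Fin dh → ℝ) := by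
    unfold hTerm; fun_prop
  refine (PiLp.continuous_toLp 2 _).comp (continuous_pi fun ij => ?_)
  simp only [Matrix.vec, momentFun, Matrix.vecMulVec_apply]
  fun_prop

/-- The Jacobian matrix represents the Fréchet derivative of `vec(f)`. -/
theorem toEuclideanLin_momentJacobian (θ : Param u d e) (z : Obs u d e p) :
    LinearMap.toContinuousLinearMap (momentJacobian Γ₀ B₀ g h P θ z).toEuclideanLin =
      fderiv ℝ (fun t => momentVec Γ₀ B₀ g h P t z) θ := by
  refine ContinuousLinearMap.coe_injective
    ((EuclideanSpace.basisFun _ ℝ).toBasis.ext fun j => ?_)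
  ext i
  simp [momentJacobian]

/-- The asymptotic covariance is `M D₁ Mᵀ` for the linearization matrix `M = -(C₁ᵀ C₁)⁻¹ C₁ᵀ`. -/
theorem asympCov_eq (θ : Param u d e) :
    asympCov Γ₀ B₀ g h P θ =
      -(((C₁ Γ₀ B₀ g h P θ)ᵀ * C₁ Γ₀ B₀ g h P θ)⁻¹ * (C₁ Γ₀ B₀ g h P θ)ᵀ) * D₁ Γ₀ B₀ g h P θ *
        (-(((C₁ Γ₀ B₀ g h P θ)ᵀ * C₁ Γ₀ B₀ g h P θ)⁻¹ * (C₁ Γ₀ B₀ g h P θ)ᵀ))ᵀ := by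
  rw [Matrix.transpose_neg, Matrix.neg_mul, Matrix.mul_neg, Matrix.neg_mul, neg_neg,
    Matrix.transpose_mul, Matrix.transpose_nonsing_inv, Matrix.transpose_mul,
    Matrix.transpose_transpose]
  simp only [asympCov, Matrix.mul_assoc]

end Moment

end InnerEnvelope

/-! ### Asymptotic normality of the envelope estimator -/

theorem theorem1 {u d e p dg dh : ℕ}
    -- `Γ₀` and `B₀`: any choice of semi-orthogonal bases of the orthogonal complements
    (Γ₀ : Matrix (Fin d ⊕ Fin e) (Fin u) ℝ → Matrix (RespIdx u d e) (Fin d ⊕ Fin e) ℝ)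
    (hΓ₀ : ∀ γ, IsOrthComplement (basisMatrix γ) (Γ₀ γ))
    (B₀ : Matrix (Fin e) (Fin d) ℝ → Matrix (Fin d ⊕ Fin e) (Fin e) ℝ)
    (hB₀ : ∀ b, IsOrthComplement (basisMatrix b) (B₀ b))
    (g : (Fin e → ℝ) → (Fin dg → ℝ)) (hg : ContDiff ℝ 1 g)
    (h : (Fin u → ℝ) × (Fin p → ℝ) → (Fin dh → ℝ)) (hh : ContDiff ℝ 1 h)
    -- the i.i.d. sample, with common law `P`
    {Ω : Type*} [MeasurableSpace Ω] (μ : Measure Ω) [IsProbabilityMeasure μ]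
    (P : Measure (Obs u d e p)) [IsProbabilityMeasure P]
    (Y : ℕ → Ω → (RespIdx u d e → ℝ)) (X : ℕ → Ω → (Fin p → ℝ))
    (hlaw : ∀ i, HasLaw (fun ω => (Y i ω, X i ω)) P μ)
    (hindep : iIndepFun (fun i ω => (Y i ω, X i ω)) μ)
    -- the parameter space and the true parameter
    (Θ : Set (Param u d e)) (θ₀ : Param u d e)
    -- the expectations in the definition of `f` exist
    (hgint : ∀ θ ∈ Θ, Integrable (gTerm Γ₀ B₀ g θ : Obs u d e p → Fin dg → ℝ) P)
    (hhint : ∀ θ ∈ Θ, Integrable (hTerm h θ : Obs u d e p → Fin dh → ℝ) P)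
    -- `f` is continuously differentiable in `θ`
    (hfcont : ∀ z, ContinuousOn (fun θ => momentVec Γ₀ B₀ g h P θ z) Θ)
    (hfdiff : ∀ z, ContDiffOn ℝ 1 (fun θ => momentVec Γ₀ B₀ g h P θ z) (interior Θ))
    -- the moment equation holds at the true parameter, and the variance of `f` exists
    (hzero : ∫ z, momentVec Γ₀ B₀ g h P θ₀ z ∂P = 0)
    (hvar : MemLp (momentVec Γ₀ B₀ g h P θ₀) 2 P)
    -- (S1)
    (hS1 : ∀ θ ∈ Θ, θ ≠ θ₀ → ∫ z, momentVec Γ₀ B₀ g h P θ z ∂P ≠ 0)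
    (hS1' : θ₀ ∈ interior Θ)
    -- (S2)
    (hS2 : IsCompact Θ)
    -- (S3)
    (hS3 : ∫⁻ z, ⨆ θ ∈ Θ, ‖momentVec Γ₀ B₀ g h P θ z‖ₑ ∂P < ⊤)
    -- (S4): `C₁` exists and is continuous on a neighbourhood of the true parameter
    (ε : ℝ) (hε : 0 < ε) (hεΘ : Metric.ball θ₀ ε ⊆ Θ)
    (hS4 : ∀ θ ∈ Metric.ball θ₀ ε, ∀ i j,
      Integrable (fun z => momentJacobian Γ₀ B₀ g h P θ z i j) P)
    (hS4' : ContinuousOn (C₁ Γ₀ B₀ g h P) (Metric.ball θ₀ ε))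
    -- (S5): full column rank
    (hS5 : (C₁ Γ₀ B₀ g h P θ₀).rank = Fintype.card (ParamIdx u d e))
    -- (S6)
    (hS6 : ∀ δ : ENNReal, 0 < δ →
      Tendsto (fun n : ℕ => μ {ω | δ ≤ ⨆ θ ∈ Metric.ball θ₀ ε,
        ENNReal.ofReal (frobNorm (((n : ℝ)⁻¹ •
            (∑ i ∈ Finset.range n, momentJacobian Γ₀ B₀ g h P θ (Y i ω, X i ω)))
          - C₁ Γ₀ B₀ g h P θ))}) atTop (𝓝 0))
    -- the estimator: a random vector that minimizes the squared norm over the parameter space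
    (θhat : ℕ → Ω → Param u d e) (hmeas : ∀ n, AEMeasurable (θhat n) μ)
    (hmin : ∀ n, ∀ᵐ ω ∂μ, θhat n ω ∈ Θ ∧
      IsMinOn (fun θ => ‖∑ i ∈ Finset.range n, momentVec Γ₀ B₀ g h P θ (Y i ω, X i ω)‖ ^ 2)
        Θ (θhat n ω)) :
    TendstoInDistribution (fun (n : ℕ) ω => Real.sqrt n • (θhat n ω - θ₀)) atTop
      (id : Param u d e → Param u d e) (fun _ => μ)
      (multivariateGaussian 0 (asympCov Γ₀ B₀ g h P θ₀)) := by
  set ξ : ℕ → Ω → Obs u d e p := fun i ω => (Y i ω, X i ω) with hξ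
  set A := C₁ Γ₀ B₀ g h P θ₀ with hA
  set f := momentVec Γ₀ B₀ g h P with hf
  have hfm (θ : Param u d e) : Measurable (f θ) :=
    (continuous_momentVec hg.continuous hh.continuous θ).measurable
  have hballint : Metric.ball θ₀ ε ⊆ interior Θ := interior_maximal hεΘ Metric.isOpen_ball
  have hθ₀ : θ₀ ∈ Θ := hεΘ (Metric.mem_ball_self hε)
  obtain ⟨hFcont, hunifLaw⟩ := ae_tendstoUniformlyOn_average hS2 hfcont hfm hS3 hlaw hindep
  have hcons : TendstoInMeasure μ θhat atTop fun _ => θ₀ := by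
    refine tendstoInMeasure_of_tendsto_ae (fun n => (hmeas n).aestronglyMeasurable) ?_
    filter_upwards [hunifLaw, ae_all_iff.2 hmin] with ω hω hωmin
    refine tendsto_of_norm_le_of_tendstoUniformlyOn hS2 hFcont hω hθ₀ hzero hS1
      (fun n => (hωmin n).1) fun n => ?_
    simp only [norm_smul]
    exact mul_le_mul_of_nonneg_left
      ((sq_le_sq₀ (norm_nonneg _) (norm_nonneg _)).1 ((hωmin n).2 hθ₀))
      (norm_nonneg _)
  have hident (i : ℕ) : IdentDistrib (fun ω => f θ₀ (ξ i ω)) (f θ₀) μ P :=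
    ((hlaw i).identDistrib HasLaw.id).comp (hfm θ₀)
  have hclt {ι : Type} [Fintype ι] [DecidableEq ι] (M : Matrix ι (Fin dh × Fin dg) ℝ) :=
    tendstoInDistribution_inv_sqrt_smul_sum_toEuclideanLin
    (W := fun i ω => f θ₀ (ξ i ω)) ((hident 0).memLp_iff.2 hvar)
    ((hident 0).integral_eq.trans hzero) (hindep.comp (fun _ => f θ₀) fun _ => hfm θ₀)
    (fun i => (hident i).trans (hident 0).symm) M
  have hD : (Matrix.of fun i j => cov[fun ω => f θ₀ (ξ 0 ω) i, fun ω => f θ₀ (ξ 0 ω) j; μ]) =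
      D₁ Γ₀ B₀ g h P θ₀ := by
    ext i j
    have hc (k : Fin dh × Fin dg) : AEStronglyMeasurable (fun z => f θ₀ z k) P :=
      (((EuclideanSpace.proj k).continuous.measurable (α := EuclideanSpace ℝ _)).comp
        (hfm θ₀)).aestronglyMeasurable
    have hm := covariance_map (μ := μ) (Z := ξ 0) (X := fun z => f θ₀ z i)
      (Y := fun z => f θ₀ z j) ((hlaw 0).map_eq ▸ hc i) ((hlaw 0).map_eq ▸ hc j)
      (hlaw 0).aemeasurable
    rw [(hlaw 0).map_eq] at hm
    exact hm.symm
  simp only [hD] at hclt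
  set C : Param u d e → Param u d e →L[ℝ] EuclideanSpace ℝ (Fin dh × Fin dg) :=
    fun θ => LinearMap.toContinuousLinearMap (C₁ Γ₀ B₀ g h P θ).toEuclideanLin with hC
  set N := LinearMap.toContinuousLinearMap ((Aᵀ * A)⁻¹).toEuclideanLin with hN
  have hCcont : ContinuousAt C θ₀ := by
    have h1 : ContinuousAt (C₁ Γ₀ B₀ g h P) θ₀ :=
      hS4'.continuousAt (Metric.ball_mem_nhds θ₀ hε)
    have h2 : Continuous ((LinearMap.toContinuousLinearMap.toLinearMap ∘ₗ
        (Matrix.toEuclideanLin (𝕜 := ℝ) (m := Fin dh × Fin dg)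
          (n := ParamIdx u d e)).toLinearMap)) := LinearMap.continuous_of_finiteDimensional _
    exact h2.continuousAt.comp h1
  have hNA : N ∘L ContinuousLinearMap.adjoint (C θ₀) ∘L C θ₀ =
      ContinuousLinearMap.id ℝ (Param u d e) := by
    ext1 x
    simp only [hC, hN, adjoint_toContinuousLinearMap_toEuclideanLin]
    change (Aᵀ * A)⁻¹.toEuclideanLin (Aᵀ.toEuclideanLin (A.toEuclideanLin x)) = x
    rw [← toEuclideanLin_mul_apply, ← toEuclideanLin_mul_apply, Matrix.mul_assoc,
      Matrix.nonsing_inv_mul _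
      ((Matrix.isUnit_iff_isUnit_det _).1 (isUnit_transpose_mul_self_of_rank hS5)),
      Matrix.toLpLin_one]
    rfl
  have hlin := tendstoInMeasure_linearization (f := f) (ξ := ξ) (μ := μ) hε
    (fun z θ hθ => ((hfdiff z).differentiableOn one_ne_zero).differentiableAt
      (isOpen_interior.mem_nhds (hballint hθ)))
    hCcont ?_ hcons ?_ hNA ?_
  · rw [asympCov_eq]
    refine tendstoInDistribution_of_tendstoInMeasure_sub _ _ (hclt (-((Aᵀ * A)⁻¹ * Aᵀ))) ?_
      fun n => ?_
    · convert hlin using 1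
      · ext1 n
        ext1 ω
        have hL (w : EuclideanSpace ℝ (Fin dh × Fin dg)) :
            (-((Aᵀ * A)⁻¹ * Aᵀ)).toEuclideanLin w =
              -N (ContinuousLinearMap.adjoint (C θ₀) w) := by
          simp only [hC, hN, adjoint_toContinuousLinearMap_toEuclideanLin]
          rw [map_neg, LinearMap.neg_apply, toEuclideanLin_mul_apply]
          rfl
        simp only [Pi.sub_apply, hL, map_smul, map_sum, Finset.sum_neg_distrib, smul_neg,
          sub_neg_eq_add]
      · rfl
    · exact ((hmeas n).sub_const θ₀).fun_const_smul _
  · intro δ hδ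
    -- the Frobenius norm of the Jacobian matrices dominates the operator norm of the derivatives
    refine tendsto_of_tendsto_of_tendsto_of_le_of_le tendsto_const_nhds
      (hS6 (ENNReal.ofReal δ) (ENNReal.ofReal_pos.2 hδ)) (fun _ => zero_le) fun n => ?_
    refine measure_mono fun ω => ?_
    rintro ⟨θ, hθ, hle⟩
    refine (ENNReal.ofReal_le_ofReal (hle.trans ?_)).trans (le_iSup₂ (f := fun θ _ =>
      ENNReal.ofReal (frobNorm (((n : ℝ)⁻¹ • (∑ i ∈ Finset.range n,
        momentJacobian Γ₀ B₀ g h P θ (Y i ω, X i ω))) - C₁ Γ₀ B₀ g h P θ))) θ hθ)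
    refine le_trans (le_of_eq ?_) (norm_toEuclideanLin_toContinuousLinearMap_le _)
    congr 1
    simp only [map_sub, map_smul, map_sum, toEuclideanLin_momentJacobian, hC, hf, hξ]
  · intro n
    filter_upwards [hmin n] with ω hω hball
    exact hω.2.isLocalMin (mem_interior_iff_mem_nhds.1 (hballint hball))
  · intro η hη
    have h1 := hclt (1 : Matrix (Fin dh × Fin dg) (Fin dh × Fin dg) ℝ)
    rw [Matrix.toLpLin_one] at h1
    exact exists_measure_norm_gt_le_of_tendstoInDistribution h1 hη
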